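/- A *p-point* is a nonprincipal ultrafilter $\mathcal U$ on $\omega$ such that for every decreasing sequence $X_0\supseteq X_1\supseteq\cdots$ of members of $\mathcal U$ there is $A\in\mathcal U$ with $A\setminus X_n$ finite for all $n$. A *q-point* is a nonprincipal ultrafilter $\mathcal V$ on $\omega$ such that every finite-to-one function $f:\omega\to\omega$ is injective on some member of $\mathcal V$. For an ultrafilter $\mathcal U$ on $\omega$ and ultrafilters $\mathcal V_n$ ($n<\omega$) on a set $Y$, the Fubini product is $$\lim_{n\to\mathcal U}\mathcal V_n=\{A\subseteq\omega\times Y:\{n:\{y\in Y:(n,y)\in A\}\in\mathcal V_n\}\in\mathcal U\}.$$ Let $\mathcal P_0$ be the class of all p-points and, for $k<\omega$, let $\mathcal P_{k+1}$ be the class of all $\lim_{n\to\mathcal U}\mathcal V_n$ with $\mathcal U$ a p-point and $\mathcal V_n\in\mathcal P_k$ for all $n$ (so the members of $\mathcal P_k$ are ultrafilters on $\omega^{k+1}$). Two ultrafilters $\mathcal U$ on $X$ and $\mathcal W$ on $Y$ are isomorphic if some map $f:X\to Y$, injective on a member of $\mathcal U$, satisfies $f(\mathcal U)=\mathcal W$,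 where $f(\mathcal U)=\{A\subseteq Y: f^{-1}(A)\in\mathcal U\}$. An ultrafilter on a set $X$ is a *finite iterate of Fubini products of p-points* if it is isomorphic to a member of $\mathcal P_k$ for some $k<\omega$. For ultrafilters $\mathcal U$ on $X$ and $\mathcal V$ on $\omega$, write $\mathcal V\le_T\mathcal U$ if there is a map $f:\mathcal U\to\mathcal V$ such that the image under $f$ of every filter base for $\mathcal U$ is a filter base for $\mathcal V$ (a filter base for an ultrafilter being a family of its members such that each of its members contains one from the family), and $\mathcal V\le_{RK}\mathcal U$ if there is $h:X\to\omega$ with $h(\mathcal U)=\mathcal V$. **Theorem.** Suppose $\mathcal U$ is a finite iterate of Fubini products of p-points. If $\mathcal V$ is a q-point and $\mathcal V\le_T\mathcal U$, then $\mathcal V\le_{RK}\mathcal U$. -/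

import Mathlib

/-- A nonprincipal ultrafilter: every cofinite set belongs to it. -/
def IsNonprincipal {X : Type*} (U : Ultrafilter X) : Prop :=
  (U : Filter X) ≤ Filter.cofinite

/-- A p-point: a nonprincipal ultrafilter on `ℕ` in which every decreasing sequence of members
has a pseudo-intersection that is a member. -/
def IsPPoint (U : Ultrafilter ℕ) : Prop :=
  IsNonprincipal U ∧
    ∀ S : ℕ → Set ℕ, Antitone S → (∀ n, S n ∈ U) → ∃ A ∈ U, ∀ n, (A \ S n).Finite

/-- A q-point: a nonprincipal ultrafilter on `ℕ` such that every finite-to-one function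
(equivalently, every partition of `ℕ` into finite sets) is injective on (respectively, is met in at
most one point per piece by) some member. -/
def IsQPoint (V : Ultrafilter ℕ) : Prop :=
  IsNonprincipal V ∧
    ∀ f : ℕ → ℕ, (∀ n, (f ⁻¹' {n}).Finite) → ∃ A ∈ V, Set.InjOn f A

/-- The Fubini product `lim_{x → U} V x`; see `mem_fubiniProduct` for its members. -/
def fubiniProduct {X Y : Type*} (U : Ultrafilter X) (V : X → Ultrafilter Y) :
    Ultrafilter (X × Y) :=
  U.bind fun x => (V x).map (Prod.mk x)

theorem mem_fubiniProduct {X Y : Type*} (U : Ultrafilter X) (V : X → Ultrafilter Y)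
    (A : Set (X × Y)) :
    A ∈ fubiniProduct U V ↔ {x | {y | (x, y) ∈ A} ∈ V x} ∈ U :=
  Iff.rfl

/-- The base set `ℕ × (ℕ × ⋯ × ℕ)` with `k + 1` factors. -/
def FubiniBase : ℕ → Type
  | 0 => ℕ
  | k + 1 => ℕ × FubiniBase k

/-- `k`-fold iterated Fubini products of p-points, on the base set with `k + 1` factors: for `k = 0`
the p-points themselves, for `k + 1` the products `lim_{n → U} V n` where `U` is a p-point
and every `V n` is a `k`-fold iterated product (the `V n` may differ). -/
def IsFubiniIterate : (k : ℕ) → Ultrafilter (FubiniBase k) → Prop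
  | 0, W => IsPPoint W
  | k + 1, W => ∃ (U : Ultrafilter ℕ) (V : ℕ → Ultrafilter (FubiniBase k)),
      IsPPoint U ∧ (∀ n, IsFubiniIterate k (V n)) ∧ W = fubiniProduct U V

/-- Isomorphism of ultrafilters: some map that is injective on a member of `U` carries `U`
to `W`. -/
def UltrafilterIso {X Y : Type*} (U : Ultrafilter X) (W : Ultrafilter Y) : Prop :=
  ∃ f : X → Y, (∃ A ∈ U, Set.InjOn f A) ∧ U.map f = W

/-- Finite iterates of Fubini products of p-points. Ultrafilters are taken up to isomorphism, so
that the copies of an iterated product on `ℕ` or on the `k`-element subsets of `ℕ`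
are included. -/
def IsFiniteFubiniIterate {X : Type*} (U : Ultrafilter X) : Prop :=
  ∃ (k : ℕ) (W : Ultrafilter (FubiniBase k)), IsFubiniIterate k W ∧ UltrafilterIso U W

/-- `f` is a cofinal map from `U` to `V`: the image of every filter base for `U` is a filter base
for `V`. As `U` is a base for itself, `f` maps `U` into `V`; its values outside `U` are
irrelevant. -/
def IsCofinalMap {X Y : Type*} (U : Ultrafilter X) (V : Ultrafilter Y)
    (f : Set X → Set Y) : Prop :=
  ∀ B : Set (Set X), (U : Filter X).HasBasis (· ∈ B) id →
    (V : Filter Y).HasBasis (· ∈ f '' B) id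

/-- Tukey reducibility `V ≤_T U`. -/
def TukeyReducible {X Y : Type*} (V : Ultrafilter Y) (U : Ultrafilter X) : Prop :=
  ∃ f : Set X → Set Y, IsCofinalMap U V f

/-- Rudin-Keisler reducibility `V ≤_RK U`. -/
def RudinKeislerReducible {X Y : Type*} (V : Ultrafilter Y) (U : Ultrafilter X) : Prop :=
  ∃ h : X → Y, U.map h = V

open Set

/-! A monotone cofinal map into the q-point is made continuous, so that each element of its value is
forced by a finite part of a tree. An iterated product of p-points has a base of pruned trees
admitting fusion (`IsTreeBase`), and one fusion yields such continuity below a tree `T₀`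
(`IsTreeBase.exists_continuous`). For `T ⊆ T₀`, take the first stage at which a finite part of `T`
forces some number, and let `k` be the least number forced there. For a sparse interval partition,
`T` must have a node whose rank is within 1 of the block of `k`. The q-point has a member meeting
each block at most once, so on it the block determines `k`. Each node lies on a branch, so finitely
many maps, indexed by the level of the node and the offset, link every two members; one of them is a
Rudin-Keisler reduction (`rudinKeislerReducible_of_finite`). -/

/-- A Tukey reduction between ultrafilters can be taken monotone. -/
theorem TukeyReducible.exists_monotone {X Y : Type*} {V : Ultrafilter Y} {U : Ultrafilter X}
    (h : TukeyReducible V U) :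
    ∃ g : Set X → Set Y, Monotone g ∧ (∀ A ∈ U, g A ∈ V) ∧ ∀ Z ∈ V, ∃ A ∈ U, g A ⊆ Z := by
  obtain ⟨f, hf⟩ := h
  have hmem : ∀ A ∈ U, f A ∈ V := by
    intro A hA
    have h1 := hf {B | B ∈ U} ⟨fun t => ⟨fun ht => ⟨t, ht, subset_rfl⟩,
      fun ⟨B, hB, hBt⟩ => Filter.mem_of_superset hB hBt⟩⟩
    exact h1.mem_of_mem (mem_image_of_mem f hA)
  refine ⟨fun A => ⋃ B ∈ {B | B ∈ U ∧ B ⊆ A}, f B, ?_, ?_, ?_⟩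
  · intro A A' hAA'
    exact biUnion_subset_biUnion_left fun B hB => ⟨hB.1, hB.2.trans hAA'⟩
  · intro A hA
    exact Filter.mem_of_superset (hmem A hA)
      (subset_biUnion_of_mem (u := f) (show A ∈ {B | B ∈ U ∧ B ⊆ A} from ⟨hA, subset_rfl⟩))
  · intro Z hZ
    by_contra! hcon
    -- Failure at `Z` makes the members whose image is not inside `Z` a base, and the image of this
    -- base cannot refine `Z`.
    have h1 := hf {B | B ∈ U ∧ ¬ f B ⊆ Z} ⟨fun t => ⟨fun ht => by
      have h2 := hcon t ht
      simp only [iUnion_subset_iff, not_forall] at h2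
      obtain ⟨B, hB, hBZ⟩ := h2
      exact ⟨B, ⟨hB.1, hBZ⟩, hB.2⟩,
      fun ⟨B, hB, hBt⟩ => Filter.mem_of_superset hB.1 hBt⟩⟩
    obtain ⟨_, ⟨B, hB, rfl⟩, hBZ⟩ := h1.mem_iff.1 hZ
    exact hB.2 hBZ

/-! ### Interval partitions and diagonalisation -/

/-- The least index `i` with `t < n i`, for a strictly increasing sequence `n`. -/
noncomputable def blockIndex (n : ℕ → ℕ) (t : ℕ) : ℕ := sInf {i | t < n i}

theorem lt_blockIndex {n : ℕ → ℕ} (hn : StrictMono n) (t : ℕ) : t < n (blockIndex n t) :=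
  Nat.sInf_mem (s := {i | t < n i}) ⟨t + 1, (Nat.lt_succ_self t).trans_le (hn.id_le _)⟩

theorem le_of_lt_blockIndex {n : ℕ → ℕ} {t i : ℕ} (h : i < blockIndex n t) : n i ≤ t :=
  not_lt.1 (Nat.notMem_of_lt_sInf (s := {i | t < n i}) h)

/-- A binary relation on `ℕ` that can always be solved by large numbers has an increasing chain. -/
theorem exists_strictMono_chain {R : ℕ → ℕ → Prop} (h : ∀ a, ∃ b, a < b ∧ R a b) :
    ∃ n : ℕ → ℕ, StrictMono n ∧ ∀ i, R (n i) (n (i + 1)) := by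
  choose f hf hR using h
  refine ⟨fun i => f^[i] 0, strictMono_nat_of_lt_succ fun i => ?_, fun i => ?_⟩
  · simpa only [Function.iterate_succ_apply'] using hf _
  · simpa only [Function.iterate_succ_apply'] using hR _

/-- In a p-point, a sequence of members converging to the whole set has, along every infinite
set of indices, a subsequence whose intersection is a member. -/
theorem IsPPoint.exists_infinite_subset {U : Ultrafilter ℕ} (hU : IsPPoint U)
    (D : ℕ → Set ℕ) (hD : ∀ l, D l ∈ U) (hlim : ∀ t, {l | t ∉ D l}.Finite)
    {L : Set ℕ} (hL : L.Infinite) :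
    ∃ L' ⊆ L, L'.Infinite ∧ ∃ T ∈ U, ∀ l ∈ L', T ⊆ D l := by
  obtain ⟨C, hC, hCD⟩ := hU.2 (fun n => ⋂ l ∈ Iic n, D l)
    (fun a b hab => biInter_subset_biInter_left (Iic_subset_Iic.2 hab))
    (fun n => (Filter.biInter_mem (finite_Iic n)).2 fun l _ => hD l)
  have hfin : ∀ l, (C \ D l).Finite := fun l =>
    (hCD l).subset (sdiff_subset_sdiff_right (biInter_subset_of_mem (mem_Iic.2 le_rfl)))
  obtain ⟨n, hn, hR⟩ := exists_strictMono_chain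
    (R := fun a b => b ∈ L ∧ (∀ t ∈ C, b ≤ t → t ∈ D a) ∧ ∀ t < a, ∀ l ≥ b, t ∈ D l) (by
      intro a
      obtain ⟨m₁, hm₁⟩ := (hfin a).bddAbove
      obtain ⟨m₂, hm₂⟩ := ((finite_Iio a).biUnion fun t _ => hlim t).bddAbove
      obtain ⟨b, hb, hlt⟩ := hL.exists_gt (a + m₁ + m₂)
      refine ⟨b, by omega, hb, fun t ht hbt => ?_, fun t ht l hl => ?_⟩
      · by_contra h
        have := hm₁ ⟨ht, h⟩
        omega
      · by_contra h
        have := hm₂ (mem_biUnion (mem_Iio.2 ht) h)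
        omega)
  -- Before the block of `t` the pseudo-intersection gives membership, after it convergence does;
  -- only two indices are uncontrolled.
  have hfut : ∀ t ∈ C, ∀ j, j ≠ blockIndex n t → j + 1 ≠ blockIndex n t → t ∈ D (n j) := by
    intro t ht j h1 h2
    rcases lt_or_gt_of_ne h1 with h | h
    · exact (hR j).2.1 t ht (le_of_lt_blockIndex (by omega))
    · exact (hR (blockIndex n t)).2.2 t (lt_blockIndex hn t) _ (hn.monotone h)
  obtain ⟨r, hr, hrU⟩ := (Ultrafilter.finite_biUnion_mem_iff (f := U) (finite_Iio 3)
    (s := fun r => {t | blockIndex n t % 3 = r})).1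
      (Filter.mem_of_superset Filter.univ_mem fun t _ =>
        mem_biUnion (mem_Iio.2 (Nat.mod_lt (blockIndex n t) (by norm_num))) rfl)
  have hr3 : r < 3 := hr
  -- With blocks congruent to `r` mod 3, indices congruent to `r + 1` avoid both uncontrolled
  -- positions.
  refine ⟨range fun j => n (3 * j + r + 1), ?_, ?_, C ∩ {t | blockIndex n t % 3 = r},
    Filter.inter_mem hC hrU, ?_⟩
  · rintro _ ⟨j, rfl⟩
    exact (hR _).1
  · exact infinite_range_of_injective fun i j hij => by have := hn.injective hij; omega
  · rintro _ ⟨j, rfl⟩ t ⟨htC, ht⟩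
    have ht' : blockIndex n t % 3 = r := ht
    exact hfut t htC _ (by omega) (by omega)

/-- Diagonalisation: properties of infinite sets that are invariant under almost inclusion and
dense can be satisfied simultaneously. -/
theorem exists_infinite_forall {P : ℕ → Set ℕ → Prop}
    (hP : ∀ n L L', (L' \ L).Finite → P n L → P n L')
    (hd : ∀ n L, L.Infinite → ∃ L' ⊆ L, L'.Infinite ∧ P n L') {L : Set ℕ} (hL : L.Infinite) :
    ∃ L' ⊆ L, L'.Infinite ∧ ∀ n, P n L' := by
  choose f hfsub hfinf hfP using hd
  let S : ℕ → {L : Set ℕ // L.Infinite} := fun n =>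
    Nat.rec ⟨L, hL⟩ (fun n L => ⟨f n L.1 L.2, hfinf n L.1 L.2⟩) n
  have hS : ∀ n, (S (n + 1)).1 ⊆ (S n).1 := fun n => hfsub n _ _
  have hSP : ∀ n, P n (S (n + 1)).1 := fun n => hfP n _ _
  have hanti : Antitone fun n => (S n).1 := antitone_nat_of_succ_le hS
  choose e heS hegt using fun n m => (S n).2.exists_gt m
  let a : ℕ → ℕ := fun n => Nat.rec (e 0 0) (fun n x => e (n + 1) x) n
  have ha : StrictMono a := strictMono_nat_of_lt_succ fun n => hegt (n + 1) _
  have haS : ∀ n, a n ∈ (S n).1 := by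
    intro n
    cases n with
    | zero => exact heS 0 0
    | succ n => exact heS (n + 1) _
  refine ⟨range a, ?_, infinite_range_of_injective ha.injective, fun n => ?_⟩
  · rintro _ ⟨n, rfl⟩
    exact hanti (Nat.zero_le n) (haS n)
  · refine hP n _ _ (((finite_Iic n).image a).subset ?_) (hSP n)
    rintro _ ⟨⟨m, rfl⟩, hm⟩
    refine mem_image_of_mem a (mem_Iic.2 ?_)
    by_contra! h
    exact hm (hanti (show n + 1 ≤ m from h) (haS m))

/-! ### Tree bases and their Fubini products -/

/-- A base of an ultrafilter consisting of (sets of branches of) pruned trees. A point `x` passes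
through the finitely many nodes `node j x`; a tree `T` is identified with its set of nodes, and
its branches are the points all of whose nodes lie in `T`. -/
structure IsTreeBase {X N J : Type*} (W : Ultrafilter X) (node : J → X → N) (box : ℕ → Set N)
    (trees : Set (Set N)) : Prop where
  box_finite : ∀ l, (box l).Finite
  box_mono : Monotone box
  box_exhausts : ∀ t, ∃ l, t ∈ box l
  univ_mem : univ ∈ trees
  inter_mem : ∀ S ∈ trees, ∀ T ∈ trees, S ∩ T ∈ trees
  branches_mem : ∀ T ∈ trees, {x | ∀ j, node j x ∈ T} ∈ W
  exists_subset : ∀ A ∈ W, ∃ T ∈ trees, {x | ∀ j, node j x ∈ T} ⊆ A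
  pruned : ∀ T ∈ trees, ∀ t ∈ T, ∃ x, (∀ j, node j x ∈ T) ∧ ∃ j, node j x = t
  /-- Outside the finite part `D ∩ box l`, a tree `D` can be enlarged to one that contains `box l`
  without affecting which trees that agree with `D` on `box l` are below it. -/
  fill : ∀ D ∈ trees, ∀ l, ∃ E ∈ trees, box l ⊆ E ∧ ∀ T ∈ trees, T ⊆ E → T ∩ box l ⊆ D → T ⊆ D
  fusion : ∀ D : ℕ → Set N, (∀ l, D l ∈ trees) → (∀ t, {l | t ∉ D l}.Finite) →
    ∀ L : Set ℕ, L.Infinite → ∃ L' ⊆ L, L'.Infinite ∧ ∃ T ∈ trees, ∀ l ∈ L', T ⊆ D l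

theorem IsTreeBase.biInter_mem {X N J ι : Type*} {W : Ultrafilter X} {node : J → X → N}
    {box : ℕ → Set N} {trees : Set (Set N)} (h : IsTreeBase W node box trees) {s : Set ι}
    (hs : s.Finite) {D : ι → Set N} (hD : ∀ i ∈ s, D i ∈ trees) : ⋂ i ∈ s, D i ∈ trees := by
  induction s, hs using Set.Finite.induction_on with
  | empty => simpa using h.univ_mem
  | insert _ _ ih =>
    rw [biInter_insert]
    exact h.inter_mem _ (hD _ (mem_insert _ _)) _ (ih fun i hi => hD i (mem_insert_of_mem _ hi))

/-- The members of a p-point form a tree base. -/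
theorem IsPPoint.isTreeBase {U : Ultrafilter ℕ} (hU : IsPPoint U) :
    IsTreeBase U (fun (_ : Unit) (x : ℕ) => x) Iio {A | A ∈ U} where
  box_finite := finite_Iio
  box_mono := fun _ _ h => Iio_subset_Iio h
  box_exhausts := fun t => ⟨t + 1, Nat.lt_succ_self t⟩
  univ_mem := Filter.univ_mem
  inter_mem := fun _ hS _ hT => Filter.inter_mem hS hT
  branches_mem := fun T hT => by simpa using hT
  exists_subset := fun A hA => ⟨A, hA, fun x hx => hx ()⟩
  pruned := fun T _ t ht => ⟨t, fun _ => ht, (), rfl⟩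
  fill := fun D hD l => ⟨D ∪ Iio l, Filter.mem_of_superset hD subset_union_left,
    subset_union_right, fun T _ hTE hTD t ht => (hTE ht).elim id fun h => hTD ⟨ht, h⟩⟩
  fusion := fun D hD hlim _ hL => hU.exists_infinite_subset D hD hlim hL

/-- The trees of a Fubini product: the root has `U`-many successors, and above the successor `n`
(coded as `(n, none)`) there is a tree of the `n`-th factor. -/
def fubiniTrees {N : Type*} (U : Ultrafilter ℕ) (trees : ℕ → Set (Set N)) :
    Set (Set (ℕ × Option N)) :=
  {T | {n | (n, none) ∈ T} ∈ U ∧ (∀ n, (n, none) ∈ T → {t | (n, some t) ∈ T} ∈ trees n) ∧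
    ∀ n t, (n, some t) ∈ T → (n, none) ∈ T}

/-- The tree with set of immediate successors `S` of the root and the tree `F n` above `n`. -/
def joinTree {N : Type*} (S : Set ℕ) (F : ℕ → Set N) : Set (ℕ × Option N) :=
  {p | p.1 ∈ S ∧ ∀ t ∈ p.2, t ∈ F p.1}

@[simp] theorem mem_joinTree_none {N : Type*} {S : Set ℕ} {F : ℕ → Set N} {n : ℕ} :
    (n, none) ∈ joinTree S F ↔ n ∈ S := by simp [joinTree]

@[simp] theorem mem_joinTree_some {N : Type*} {S : Set ℕ} {F : ℕ → Set N} {n : ℕ} {t : N} :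
    (n, some t) ∈ joinTree S F ↔ n ∈ S ∧ t ∈ F n := by simp [joinTree]

theorem joinTree_mem {N : Type*} {U : Ultrafilter ℕ} {trees : ℕ → Set (Set N)} {S : Set ℕ}
    {F : ℕ → Set N} (hS : S ∈ U) (hF : ∀ n ∈ S, F n ∈ trees n) :
    joinTree S F ∈ fubiniTrees U trees := by
  refine ⟨by simpa using hS, fun n hn => ?_, fun n t h => ?_⟩
  · have hn' : n ∈ S := by simpa using hn
    simpa [hn'] using hF n hn'
  · simp only [mem_joinTree_some] at h
    simpa using h.1

/-- Fusion is done in each factor, diagonalised over the countably many factors, and then done at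
the root by the p-point property of `U`. -/
theorem IsPPoint.isTreeBase_fubiniProduct {Y N J : Type*} {U : Ultrafilter ℕ} (hU : IsPPoint U)
    {V : ℕ → Ultrafilter Y} {node : J → Y → N} {box : ℕ → Set N} {trees : ℕ → Set (Set N)}
    (h : ∀ n, IsTreeBase (V n) node box (trees n)) :
    IsTreeBase (fubiniProduct U V)
      (fun (j : Option J) (x : ℕ × Y) => (x.1, j.map fun i => node i x.2))
      (fun l => joinTree (Iio l) fun _ => box l) (fubiniTrees U trees) where
  box_finite := fun l => by
    refine ((finite_Iio l).prod (((h 0).box_finite l).image some |>.insert none)).subset ?_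
    rintro ⟨n, _ | t⟩ hp
    · exact ⟨by simpa using hp, by simp⟩
    · simp only [mem_joinTree_some] at hp
      exact ⟨hp.1, by simpa using hp.2⟩
  box_mono := fun a b hab p hp =>
    ⟨lt_of_lt_of_le hp.1 hab, fun t ht => (h 0).box_mono hab (hp.2 t ht)⟩
  box_exhausts := by
    rintro ⟨n, _ | t⟩
    · exact ⟨n + 1, by simp⟩
    · obtain ⟨l, hl⟩ := (h 0).box_exhausts t
      refine ⟨max l (n + 1), ?_⟩
      simp only [mem_joinTree_some]
      exact ⟨lt_of_lt_of_le (Nat.lt_succ_self n) (le_max_right _ _),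
        (h 0).box_mono (le_max_left _ _) hl⟩
  univ_mem := ⟨Filter.univ_mem' fun _ => mem_univ _, fun n _ => by simpa using (h n).univ_mem, by simp⟩
  inter_mem := fun S hS T hT => ⟨Filter.inter_mem hS.1 hT.1,
    fun n hn => (h n).inter_mem _ (hS.2.1 n hn.1) _ (hT.2.1 n hn.2),
    fun n t ht => ⟨hS.2.2 n t ht.1, hT.2.2 n t ht.2⟩⟩
  branches_mem := fun T hT => by
    rw [mem_fubiniProduct]
    filter_upwards [hT.1] with n hn
    filter_upwards [(h n).branches_mem _ (hT.2.1 n hn)] with y hy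
    rintro (_ | j)
    · exact hn
    · exact hy j
  exists_subset := fun A hA => by
    rw [mem_fubiniProduct] at hA
    have : ∀ n, ∃ F, {y | (n, y) ∈ A} ∈ V n →
        F ∈ trees n ∧ {y | ∀ j, node j y ∈ F} ⊆ {y | (n, y) ∈ A} := by
      intro n
      by_cases hn : {y | (n, y) ∈ A} ∈ V n
      · obtain ⟨F, h1, h2⟩ := (h n).exists_subset _ hn
        exact ⟨F, fun _ => ⟨h1, h2⟩⟩
      · exact ⟨∅, fun h => absurd h hn⟩
    choose F hF using this
    refine ⟨joinTree _ F, joinTree_mem hA fun n hn => (hF n hn).1, ?_⟩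
    rintro ⟨n, y⟩ hx
    have hn : {y | (n, y) ∈ A} ∈ V n := by simpa using hx none
    refine (hF n hn).2 fun j => ?_
    have := hx (some j)
    simp only [Option.map_some, mem_joinTree_some] at this
    exact this.2
  pruned := by
    rintro T hT ⟨n, t⟩ ht
    have key : ∀ y, (n, none) ∈ T → (∀ j, node j y ∈ {t | (n, some t) ∈ T}) →
        ∀ j : Option J, (n, j.map fun i => node i y) ∈ T := by
      rintro y hn hy (_ | j)
      · exact hn
      · exact hy j
    rcases t with _ | t
    · obtain ⟨y, hy⟩ := (V n).nonempty_of_mem ((h n).branches_mem _ (hT.2.1 n ht))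
      exact ⟨(n, y), key y ht hy, none, rfl⟩
    · have hn := hT.2.2 n t ht
      obtain ⟨y, hy, j, rfl⟩ := (h n).pruned _ (hT.2.1 n hn) t ht
      exact ⟨(n, y), key y hn hy, some j, rfl⟩
  fill := fun D hD l => by
    have : ∀ n, ∃ E, (n < l ∨ (n, none) ∈ D → E ∈ trees n) ∧ (n < l → box l ⊆ E) ∧
        ((n, none) ∈ D → ∀ T ∈ trees n, T ⊆ E → (n < l → T ∩ box l ⊆ {t | (n, some t) ∈ D}) →
          T ⊆ {t | (n, some t) ∈ D}) := by
      intro n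
      by_cases hn : (n, none) ∈ D
      · by_cases hl : n < l
        · obtain ⟨E, h1, h2, h3⟩ := (h n).fill _ (hD.2.1 n hn) l
          exact ⟨E, fun _ => h1, fun _ => h2, fun _ T hT hTE hTD => h3 T hT hTE (hTD hl)⟩
        · exact ⟨_, fun _ => hD.2.1 n hn, fun h => absurd h hl, fun _ T _ hTE _ => hTE⟩
      · exact ⟨univ, fun _ => (h n).univ_mem, fun _ => subset_univ _, fun h => absurd h hn⟩
    choose E hE hbox hfill using this
    refine ⟨joinTree {n | n < l ∨ (n, none) ∈ D} E,
      joinTree_mem (Filter.mem_of_superset hD.1 fun n hn => Or.inr hn) hE, ?_, ?_⟩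
    · rintro ⟨n, _ | t⟩ hp
      · exact mem_joinTree_none.2 (Or.inl (mem_joinTree_none.1 hp))
      · obtain ⟨hn, ht⟩ := mem_joinTree_some.1 hp
        exact mem_joinTree_some.2 ⟨Or.inl hn, hbox n hn ht⟩
    · intro T hT hTE hTD
      have hroot : ∀ n, (n, none) ∈ T → (n, none) ∈ D := fun n hn =>
        (mem_joinTree_none.1 (hTE hn)).elim
          (fun hl => hTD ⟨hn, mem_joinTree_none.2 hl⟩) id
      rintro ⟨n, _ | t⟩ ht
      · exact hroot n ht
      · have hn := hT.2.2 n t ht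
        exact hfill n (hroot n hn) _ (hT.2.1 n hn)
          (fun u hu => (mem_joinTree_some.1 (hTE hu)).2)
          (fun hl u hu => hTD ⟨hu.1, mem_joinTree_some.2 ⟨hl, hu.2⟩⟩) ht
  fusion := fun D hD hlim L hL => by
    let P : ℕ → Set ℕ → Prop := fun n L => ∃ T ∈ trees n, ∀ l ∈ L, (n, none) ∈ D l →
      T ⊆ {t | (n, some t) ∈ D l}
    -- If `n` is not a successor of the root in `D l`, the section is replaced by `univ`, which is a
    -- tree and imposes nothing.
    let D' : ℕ → ℕ → Set N := fun n l => {t | (n, none) ∈ D l → (n, some t) ∈ D l}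
    have hD' : ∀ n l, D' n l ∈ trees n := by
      intro n l
      by_cases hn : (n, none) ∈ D l
      · simpa [D', hn] using (hD l).2.1 n hn
      · simpa [D', hn] using (h n).univ_mem
    obtain ⟨L₁, hL₁, hinf₁, hP⟩ := exists_infinite_forall (P := P) (by
        rintro n L L' hfin ⟨T, hT, hTL⟩
        refine ⟨T ∩ ⋂ l ∈ L' \ L, D' n l, (h n).inter_mem _ hT _
          ((h n).biInter_mem hfin fun l _ => hD' n l), fun l hl hn t ht => ?_⟩
        by_cases hlL : l ∈ L
        · exact hTL l hlL hn ht.1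
        · exact mem_iInter₂.1 ht.2 l ⟨hl, hlL⟩ hn) (by
        intro n L hL
        obtain ⟨L', hsub, hinf, T, hT, hTL⟩ := (h n).fusion (D' n) (hD' n)
          (fun t => (hlim (n, some t)).subset fun l hl hmem => hl fun _ => hmem) L hL
        exact ⟨L', hsub, hinf, T, hT, fun l hl hn t ht => hTL l hl ht hn⟩) hL
    choose T hT hTL using hP
    obtain ⟨L₂, hL₂, hinf₂, S, hS, hSL⟩ := hU.exists_infinite_subset
      (fun l => {n | (n, none) ∈ D l}) (fun l => (hD l).1) (fun n => hlim (n, none)) hinf₁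
    refine ⟨L₂, hL₂.trans hL₁, hinf₂, joinTree S T, joinTree_mem hS fun n _ => hT n, ?_⟩
    rintro l hl ⟨n, _ | t⟩ hp
    · exact hSL l hl (mem_joinTree_none.1 hp)
    · obtain ⟨hn, ht⟩ := mem_joinTree_some.1 hp
      exact hTL n l (hL₂ hl) (hSL l hl hn) ht

/-- Nodes and boxes depend on `k` alone, so the different factors of a product can share them; `J`
is finite to leave finitely many maps at the end. -/
theorem exists_isTreeBase_of_isFubiniIterate (k : ℕ) :
    ∃ (N J : Type) (_ : Finite J) (node : J → FubiniBase k → N) (box : ℕ → Set N),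
      ∀ W : Ultrafilter (FubiniBase k), IsFubiniIterate k W →
        ∃ trees, IsTreeBase W node box trees := by
  induction k with
  | zero => exact ⟨ℕ, Unit, inferInstance, fun _ x => x, Iio, fun W hW =>
      ⟨_, IsPPoint.isTreeBase (U := W) hW⟩⟩
  | succ k ih =>
    obtain ⟨N, J, _, node, box, ih⟩ := ih
    refine ⟨ℕ × Option N, Option J, inferInstance,
      fun (j : Option J) (x : ℕ × FubiniBase k) => (x.1, j.map fun i => node i x.2),
      fun l => joinTree (Iio l) fun _ => box l, ?_⟩
    rintro _ ⟨U, V, hU, hV, rfl⟩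
    choose trees htrees using fun n => ih (V n) (hV n)
    exact ⟨_, hU.isTreeBase_fubiniProduct htrees⟩

/-! ### Continuity and the Rudin-Keisler reduction -/

/-- If every member of `W` and every member of `V` are linked by one of finitely many maps, then
one of these maps takes `W` to `V`. -/
theorem rudinKeislerReducible_of_finite {X Y ι : Type*} [Finite ι] {W : Ultrafilter X}
    {V : Ultrafilter Y} (h : ι → X → Y)
    (hlink : ∀ A ∈ W, ∀ Z ∈ V, ∃ i, ∃ x ∈ A, h i x ∈ Z) : RudinKeislerReducible V W := by
  by_contra hcon
  have hex : ∀ i, ∃ Z ∈ V, h i ⁻¹' Z ∉ W := by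
    intro i
    by_contra! hall
    exact hcon ⟨h i, Ultrafilter.eq_of_le fun Z hZ => hall Z hZ⟩
  choose Z hZ hZW using hex
  obtain ⟨i, x, hx, hxZ⟩ := hlink (⋂ i, (h i ⁻¹' Z i)ᶜ)
    (Filter.iInter_mem.2 fun i => Ultrafilter.compl_mem_iff_notMem.2 (hZW i))
    (⋂ i, Z i) (Filter.iInter_mem.2 hZ)
  exact mem_iInter.1 hx i (mem_iInter.1 hxZ i)

/-- Below some tree, the values of a monotone map are decided by finite parts of trees. -/
theorem IsTreeBase.exists_continuous {X N J : Type*} {W : Ultrafilter X} {node : J → X → N}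
    {box : ℕ → Set N} {trees : Set (Set N)} (h : IsTreeBase W node box trees)
    {G : Set N → Set ℕ} (hG : Monotone G) :
    ∃ L : Set ℕ, L.Infinite ∧ ∃ T₀ ∈ trees, ∀ T ∈ trees, T ⊆ T₀ → ∀ l ∈ L, ∀ k ∈ G T, k < l →
      ∀ S ∈ trees, T ∩ box l ⊆ S → k ∈ G S := by
  -- If some tree containing `s` omits `k` from its value, filling that tree gives `E`, below which
  -- no tree with trace `s` has `k` in its value.
  have hE : ∀ (l k : ℕ) (s : Set N), ∃ E ∈ trees, box l ⊆ E ∧ ∀ T ∈ trees, T ⊆ E →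
      T ∩ box l = s → k ∈ G T → ∀ S ∈ trees, s ⊆ S → k ∈ G S := by
    intro l k s
    by_cases hs : ∀ S ∈ trees, s ⊆ S → k ∈ G S
    · exact ⟨univ, h.univ_mem, subset_univ _, fun _ _ _ _ _ => hs⟩
    · push Not at hs
      obtain ⟨D, hD, hsD, hk⟩ := hs
      obtain ⟨E, hE, hbox, hfill⟩ := h.fill D hD l
      exact ⟨E, hE, hbox, fun T hT hTE hTs hkT => absurd
        (hG (hfill T hT hTE (hTs.trans_subset hsD)) hkT) hk⟩
  choose E hE hbox hcont using hE
  have hfin : ∀ l, ((Iio l) ×ˢ {s | s ⊆ box l}).Finite := fun l =>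
    (finite_Iio l).prod (h.box_finite l).finite_subsets
  obtain ⟨L, -, hL, T₀, hT₀, hTL⟩ := h.fusion
    (fun l => ⋂ p ∈ (Iio l) ×ˢ {s | s ⊆ box l}, E l p.1 p.2)
    (fun l => h.biInter_mem (hfin l) fun p _ => hE l p.1 p.2)
    (fun t => by
      obtain ⟨m, hm⟩ := h.box_exhausts t
      refine (finite_Iio m).subset fun l hl => ?_
      by_contra hlm
      exact hl (mem_iInter₂.2 fun p _ => hbox l p.1 p.2 (h.box_mono (not_lt.1 hlm) hm)))
    univ infinite_univ
  refine ⟨L, hL, T₀, hT₀, fun T hT hTT₀ l hl k hk hkl => ?_⟩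
  refine hcont l k _ T hT ((hTT₀.trans (hTL l hl)).trans ?_) rfl hk
  exact biInter_subset_of_mem (t := fun p : ℕ × Set N => E l p.1 p.2) (x := (k, T ∩ box l))
    (mem_prod.2 ⟨hkl, inter_subset_right⟩)

theorem IsTreeBase.rudinKeislerReducible {X N J : Type*} [Finite J] {W : Ultrafilter X}
    {node : J → X → N} {box : ℕ → Set N} {trees : Set (Set N)}
    (h : IsTreeBase W node box trees) {V : Ultrafilter ℕ} (hV : IsQPoint V)
    {g : Set X → Set ℕ} (hg : Monotone g) (hgV : ∀ A ∈ W, g A ∈ V)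
    (hcof : ∀ Z ∈ V, ∃ A ∈ W, g A ⊆ Z) : RudinKeislerReducible V W := by
  classical
  let G : Set N → Set ℕ := fun T => g {x | ∀ j, node j x ∈ T}
  have hG : Monotone G := fun S T hST => hg fun x hx j => hST (hx j)
  obtain ⟨L, hL, T₀, hT₀, hcont⟩ := h.exists_continuous hG
  -- The numbers forced by `s`; the least one `c s` defaults to 0 if there are none.
  let ψ : Set N → Set ℕ := fun s => {k | ∀ S ∈ trees, s ⊆ S → k ∈ G S}
  let c : Set N → ℕ := fun s => sInf (ψ s)
  obtain ⟨n, hn, hR⟩ := exists_strictMono_chain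
    (R := fun a b => (∃ l ∈ L, a ≤ l ∧ l ≤ b) ∧ ∀ s ⊆ box a, c s < b) (by
      intro a
      obtain ⟨l, hl, hal⟩ := hL.exists_gt a
      obtain ⟨m, hm⟩ := ((h.box_finite a).finite_subsets.image c).bddAbove
      refine ⟨l + m + 1, by omega, ⟨l, hl, hal.le, by omega⟩, fun s hs => ?_⟩
      have := hm (mem_image_of_mem c hs)
      omega)
  let rank : N → ℕ := fun t => sInf {i | t ∈ box (n i)}
  -- The bound `n 1 ≤ k` puts the block of `k` at 2 or later, so `b - 2` is not truncated.
  have hdec : ∀ T ∈ trees, T ⊆ T₀ → ∃ k ∈ G T, n 1 ≤ k →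
      ∃ t ∈ T, ∃ e : Fin 3, rank t + 1 - e = blockIndex n k := by
    intro T hT hTT₀
    have hne : ∃ l, l ∈ L ∧ (ψ (T ∩ box l)).Nonempty := by
      obtain ⟨k, hk⟩ := V.nonempty_of_mem (hgV _ (h.branches_mem T hT))
      obtain ⟨l, hl, hkl⟩ := hL.exists_gt k
      exact ⟨l, hl, k, hcont T hT hTT₀ l hl k hk hkl⟩
    set s := T ∩ box (Nat.find hne)
    have hcs : c s ∈ ψ s := Nat.sInf_mem (Nat.find_spec hne).2
    have hcT : c s ∈ G T := hcs T hT inter_subset_left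
    refine ⟨c s, hcT, fun hk => ?_⟩
    set b := blockIndex n (c s)
    have hb : 2 ≤ b := by
      have := hn.lt_iff_lt.1 (hk.trans_lt (lt_blockIndex hn (c s)))
      omega
    -- By continuity `c s` is forced by some stage `l ∈ L` with `n b ≤ l ≤ n (b + 1)`, and the
    -- chosen stage is the first.
    have hup : s ⊆ box (n (b + 1)) := by
      obtain ⟨l, hl, hl1, hl2⟩ := (hR b).1
      have hlt : c s < l := (lt_blockIndex hn _).trans_le hl1
      exact inter_subset_right.trans (h.box_mono ((Nat.find_min' hne
        ⟨hl, c s, hcont T hT hTT₀ l hl _ hcT hlt⟩).trans hl2))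
    -- A part inside `box (n (b - 2))` would have its least forced number below `n (b - 1)`, hence
    -- in an earlier block.
    have hlow : ¬ s ⊆ box (n (b - 2)) := fun hsub =>
      absurd (le_of_lt_blockIndex (show b - 2 + 1 < blockIndex n (c s) by omega))
        (not_le.2 ((hR (b - 2)).2 s hsub))
    obtain ⟨t, hts, ht⟩ := not_subset.1 hlow
    have hle : rank t ≤ b + 1 := Nat.sInf_le (hup hts)
    have hge : b - 2 < rank t := by
      by_contra! hlt
      exact ht (h.box_mono (hn.monotone hlt)
        (Nat.sInf_mem (s := {i | t ∈ box (n i)}) ⟨b + 1, hup hts⟩))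
    exact ⟨t, hts.1, ⟨rank t + 1 - b, by omega⟩, by simp only; omega⟩
  obtain ⟨Y, hY, hinj⟩ := hV.2 (blockIndex n) fun i =>
    (finite_Iio (n i)).subset fun k hk => by
      rw [mem_preimage, mem_singleton_iff] at hk
      exact hk ▸ lt_blockIndex hn k
  refine rudinKeislerReducible_of_finite
    (fun (p : J × Fin 3) x => Function.invFunOn (blockIndex n) Y (rank (node p.1 x) + 1 - p.2))
    fun A hA Z hZ => ?_
  obtain ⟨B, hB, hBZ⟩ := hcof (Z ∩ Y ∩ (Iio (n 1))ᶜ) (Filter.inter_mem (Filter.inter_mem hZ hY)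
    (hV.1 (finite_Iio (n 1)).compl_mem_cofinite))
  obtain ⟨T, hT, hTA⟩ := h.exists_subset _ (Filter.inter_mem hA hB)
  have hT' := h.inter_mem T hT T₀ hT₀
  obtain ⟨k, hk, hkt⟩ := hdec _ hT' inter_subset_right
  obtain ⟨⟨hkZ, hkY⟩, hk1⟩ := hBZ (hg (fun x hx => (hTA fun j => (hx j).1).2) hk)
  obtain ⟨t, ht, e, he⟩ := hkt (not_lt.1 hk1)
  obtain ⟨x, hx, j, rfl⟩ := h.pruned _ hT' t ht
  refine ⟨(j, e), x, (hTA fun j => (hx j).1).1, ?_⟩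
  simp only [he]
  rwa [hinj.leftInvOn_invFunOn hkY]

theorem theorem5p3 {X : Type*} (U : Ultrafilter X) (V : Ultrafilter ℕ)
    (hU : IsFiniteFubiniIterate U) (hV : IsQPoint V) (hVU : TukeyReducible V U) :
    RudinKeislerReducible V U := by
  obtain ⟨k, W, hW, f, ⟨A, hA, hfA⟩, hfW⟩ := hU
  obtain ⟨g, hg, hgV, hcof⟩ := hVU.exists_monotone
  obtain ⟨N, J, _, node, box, htree⟩ := exists_isTreeBase_of_isFubiniIterate k
  obtain ⟨trees, htrees⟩ := htree W hW
  obtain ⟨q, hq⟩ := htrees.rudinKeislerReducible hV (g := fun B => g (f ⁻¹' B ∩ A))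
    (fun B C hBC => hg (inter_subset_inter_left _ (preimage_mono hBC)))
    (fun B hB => hgV _ (Filter.inter_mem (by rw [← hfW] at hB; exact hB) hA))
    (fun Z hZ => by
      obtain ⟨B, hB, hBZ⟩ := hcof Z hZ
      -- Injectivity of `f` on `A` makes the trace on `A` of the preimage of this image lie in `B`.
      refine ⟨f '' (B ∩ A), ?_, (hg ?_).trans hBZ⟩
      · rw [← hfW]
        exact Filter.image_mem_map (Filter.inter_mem hB hA)
      · rintro x ⟨⟨y, ⟨hyB, hyA⟩, hyx⟩, hxA⟩
        rwa [← hfA hyA hxA hyx])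
  exact ⟨q ∘ f, by rw [← Ultrafilter.map_map, hfW, hq]⟩
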